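/- Let $N\ge 0$, let $\mu$ be a Radon measure on $\mathbb{R}^N$ (a Borel measure that is finite on bounded sets), and let $S\subseteq\mathbb{R}^N$ be its support, regarded as a metric measure space with the Euclidean distance and (the restriction of) $\mu$. For $f:S\to\mathbb{R}$, $a\in S$ and $r>0$ put $$L(f;a,r)=\sup\Big\{\tfrac{|f(y)-f(a)|}{r} : y\in S,\ |y-a|\le r\Big\},$$ $$\operatorname{lip}[f](a)=\liminf_{r\to0^+}L(f;a,r),\qquad \operatorname{Lip}[f](a)=\limsup_{r\to0^+}L(f;a,r).$$ Let $A\subseteq S$ be a chart of differentiability for $S$ with identity coordinates. That is: $A$ is $\mu$-measurable, $\mu(A)>0$, and for every Lipschitz function $f:S\to\mathbb{R}$ there is a $\mu$-measurable vector field $\mathbf{D}f:A\to\mathbb{R}^N$, unique up to equality $\mu$-a.e. on $A$, such that for $\mu$-a.e. $x\in A$ $$\limsup_{y\to x,\ y\in S\setminus\{x\}}\frac{|f(y)-f(x)-\mathbf{D}f(x)\cdot(y-x)|}{|y-x|}=0$$ (at an isolated point $x$ of $S$ this condition is regarded as satisfied). Then there are subsets $\mathcal{A}_1,\mathcal{A}_2,\dots$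 of $A$ with $\mu\big(A\setminus\bigcup_{n\ge1}\mathcal{A}_n\big)=0$ such that, for every integer $n\ge1$ and every Lipschitz function $f:\mathbb{R}^N\to\mathbb{R}$, $$\operatorname{Lip}[f|_S](a)\le n\,\operatorname{lip}[f|_S](a)\qquad\text{for } \mu\text{-a.e. } a\in\mathcal{A}_n .$$ -/

import Mathlib

open MeasureTheory Filter Topology
open scoped NNReal ENNReal

noncomputable section

/-- The variation `L(f; x, r)`: the supremum of `|f y - f x| / r` over the closed ball of radius
`r` around `x` in the metric space `X`, as an extended nonnegative real. -/
def variation {X : Type*} [MetricSpace X] (f : X → ℝ) (x : X) (r : ℝ) : ℝ≥0∞ :=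
  ⨆ y ∈ Metric.closedBall x r, ENNReal.ofReal (|f y - f x| / r)

/-- The lower pointwise Lipschitz constant: the liminf of `L(f; x, r)` as `r → 0`, `r > 0`. -/
def lowerPtLip {X : Type*} [MetricSpace X] (f : X → ℝ) (x : X) : ℝ≥0∞ :=
  liminf (fun r : ℝ => variation f x r) (𝓝[>] 0)

/-- The upper pointwise Lipschitz constant: the limsup of `L(f; x, r)` as `r → 0`, `r > 0`. -/
def upperPtLip {X : Type*} [MetricSpace X] (f : X → ℝ) (x : X) : ℝ≥0∞ :=
  limsup (fun r : ℝ => variation f x r) (𝓝[>] 0)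

/-- `f` is differentiable at `x` with respect to `ξ`, with differential `v`: the quotient
`|f y - f x - v · (ξ y - ξ x)| / d(x, y)` has limit superior (so, being nonnegative, limit) `0`
as `y → x` in `X`. -/
def HasDifferentialAt {X : Type*} [MetricSpace X] {N : ℕ}
    (ξ : X → EuclideanSpace ℝ (Fin N)) (f : X → ℝ) (v : EuclideanSpace ℝ (Fin N)) (x : X) : Prop :=
  Tendsto (fun y => |f y - f x - inner ℝ v (ξ y - ξ x)| / dist x y) (𝓝[≠] x) (𝓝 0)

/-- `D` is a (`μ`-measurable) differential of `f` on `Y` with respect to the coordinates `ξ`. -/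
def IsMeasurableDifferential {X : Type*} [MetricSpace X] [MeasurableSpace X] {N : ℕ}
    (μ : Measure X) (Y : Set X) (ξ : X → EuclideanSpace ℝ (Fin N)) (f : X → ℝ)
    (D : X → EuclideanSpace ℝ (Fin N)) : Prop :=
  AEMeasurable D (μ.restrict Y) ∧ ∀ᵐ x ∂(μ.restrict Y), HasDifferentialAt ξ f (D x) x

/-- `(Y, ξ)` is a chart of differentiability of the metric measure space `(X, d, μ)`: `Y` is a
`μ`-measurable set of positive measure, `ξ` is Lipschitz, and every Lipschitz function on `X` has
one and (up to equality `μ`-a.e. on `Y`) only one measurable differential on `Y` with respect to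
`ξ`. The values of the vector fields off `Y` play no role. -/
structure IsDiffChart {X : Type*} [MetricSpace X] [MeasurableSpace X] {N : ℕ}
    (μ : Measure X) (Y : Set X) (ξ : X → EuclideanSpace ℝ (Fin N)) : Prop where
  nullMeasurableSet : NullMeasurableSet Y μ
  measure_pos : 0 < μ Y
  lipschitz : ∃ K : ℝ≥0, LipschitzWith K ξ
  existsUnique_differential : ∀ f : X → ℝ, (∃ K : ℝ≥0, LipschitzWith K f) →
    ∃ D : X → EuclideanSpace ℝ (Fin N), IsMeasurableDifferential μ Y ξ f D ∧
      ∀ D' : X → EuclideanSpace ℝ (Fin N), IsMeasurableDifferential μ Y ξ f D' →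
        D' =ᵐ[μ.restrict Y] D

end

/-!
At a point `x` where `f` is differentiable with gradient `w`, the pointwise constants of `f` are those
of the linear function `w · y`. The claim therefore concerns linear functions only, and by compactness
(`exists_forall_upperPtLip_le_mul_lowerPtLip`) it holds with some `n` at every `x` with the property
that no `v` satisfies `lip[v ·](x) = 0 < Lip[v ·](x)`. The sets `𝒜 n` consist of the points where the
constant `n` works for all linear functions at once; it remains to see that they exhaust `A`
(`IsDiffChart.measure_setOf_lowerPtLip_eq_zero`).

Suppose that such a `v` exists on a set `Z` of positive measure. Around `x ∈ Z` there are then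
arbitrarily small balls in which the space lies in a very thin slab orthogonal to `v`, although at
smaller scales some points do leave `x` in directions `e` with `v · e` bounded below. A Lipschitz
function near `x` can be modified in such a ball: its slope along `v` may be changed at will at all
smaller scales, since this alters the function only by the thickness of the slab, and joining it to
the unmodified function costs only a small additional slope
(`exists_lipschitz_modification`, an explicit infimum which treats all points of a set at once).
Alternating between slope `1` and slope `0` along `v` at rapidly decreasing scales, with summable
costs, gives a single Lipschitz function (`exists_lipschitz_prescribed`). It is not differentiable on
a part of `Z` of positive measure (`exists_lipschitz_not_differentiable`): on the same direction `e` a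
gradient would have to agree with `v` and with `0`. Two selections are needed for this: `v` is
replaced by vectors from a countable dense set, chosen to be locally constant on a compact set
(`exists_isCompact_locally_constant_selection`), and the ranges of scales are taken so large that each
of them sees all the directions available at smaller scales (`exists_direction_window`).

In the compactness argument, the vectors on which the upper constant vanishes at `x` form a subspace
(`upperPtLipKer`), and are projected away.
-/

/-! ### Modifying a Lipschitz function near a set -/

/-- Admissible upper bounds `t` at `z` in the infimum defining the modified function: either `t`
bounds `G z`, or `t` bounds what is reached by starting from `G` at a point `a` near a centre
`x ∈ K`, following `ψ x` inside the ball `B(x, r x)`, and paying `L'` per unit of length. -/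
def ModificationBound {X : Type*} [MetricSpace X] (K : Set X) (ψ : X → X → ℝ) (G r : X → ℝ)
    (s L' : ℝ) (z : X) (t : ℝ) : Prop :=
  G z ≤ t ∨ ∃ x ∈ K, ∃ a, dist a x < s ∧ dist x z < r x ∧
    G a + (ψ x z - ψ x a) + L' * (dist a x + dist x z) ≤ t

/-- Let `G` be Lipschitz and, near every `x ∈ K`, agree with `φ x` up to a slope `L`. If `φ x` and
`ψ x` are both almost constant on a ball around `x` of radius `r x ∈ [s, δ]`, then `G` has a uniformly
small modification `F` which near `K` agrees with `ψ x` up to the slightly larger slope `L'`.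

`F z` is the infimum of the `t` with `ModificationBound K ψ G r s L' z t`. It stays close to `G`
because following `ψ x` instead of `φ x` inside the ball lowers the bound by at most `O(ε * r x)`,
while leaving the ball costs an additional `(L' - L) * r x`. -/
theorem exists_lipschitz_modification {X : Type*} [MetricSpace X] {K : Set X} {φ ψ : X → X → ℝ}
    {G r : X → ℝ} {L L' s s₀ δ ε σ : ℝ} (hL : 0 ≤ L) (hε : 0 ≤ ε) (hδ : 0 ≤ δ) (hLL' : 4 * ε ≤ L' - L)
    (hG : ∀ x y, |G x - G y| ≤ (1 + L) * dist x y)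
    (hGφ : ∀ x ∈ K, ∀ y, dist x y < s₀ → |G y - G x - (φ x y - φ x x)| ≤ L * dist x y)
    (hψ : ∀ x ∈ K, ∀ y z, |ψ x y - ψ x z| ≤ dist y z)
    (hψσ : ∀ x ∈ K, ∀ x' ∈ K, dist x x' < σ → ψ x = ψ x')
    (hr : ∀ x ∈ K, s ≤ r x ∧ r x ≤ δ) (hs : 0 < s)
    (hφr : ∀ x ∈ K, ∀ y, dist x y < 2 * r x → |φ x y - φ x x| ≤ ε * r x)
    (hψr : ∀ x ∈ K, ∀ y, dist x y < 2 * r x → |ψ x y - ψ x x| ≤ ε * r x)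
    (hδ₀ : 2 * δ ≤ s₀) (hδσ : 2 * δ ≤ σ) :
    ∃ F : X → ℝ, (∀ x y, |F x - F y| ≤ (1 + L') * dist x y) ∧
      (∀ x, |F x - G x| ≤ 4 * ε * δ) ∧
      ∀ x ∈ K, ∀ y, dist x y < s → |F y - F x - (ψ x y - ψ x x)| ≤ L' * dist x y := by
  have hL' : 0 ≤ L' := by linarith
  -- The gain of `G` along an excursion from `a` through the centre `x` to `z`.
  have gain : ∀ x ∈ K, ∀ a z, dist a x < s → dist x z < 2 * r x →
      G z ≤ G a + 2 * (ε * r x) + L * (dist a x + dist x z) := by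
    intro x hx a z ha hz
    have hrx := hr x hx
    have hxa : dist x a < 2 * r x := by rw [dist_comm]; linarith
    have h1 := abs_le.1 (hGφ x hx a (by linarith))
    have h2 := abs_le.1 (hGφ x hx z (by linarith))
    have h3 := abs_le.1 (hφr x hx a hxa)
    have h4 := abs_le.1 (hφr x hx z hz)
    rw [dist_comm x a] at h1
    linarith [h1.1, h2.2, h3.1, h4.2]
  -- The cost paid along the same excursion, up to the thickness of the slab.
  have cost : ∀ x ∈ K, ∀ a z, dist a x < s → dist x z < 2 * r x →
      -(2 * (ε * r x)) ≤ ψ x z - ψ x a := by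
    intro x hx a z ha hz
    have hrx := hr x hx
    have hxa : dist x a < 2 * r x := by rw [dist_comm]; linarith
    have h3 := abs_le.1 (hψr x hx a hxa)
    have h4 := abs_le.1 (hψr x hx z hz)
    linarith [h3.2, h4.1]
  have lower : ∀ z t, ModificationBound K ψ G r s L' z t → G z - 4 * ε * δ ≤ t := by
    rintro z t (h | ⟨x, hx, a, ha, hz, h⟩)
    · have : 0 ≤ 4 * ε * δ := by positivity
      linarith
    · have hrx := hr x hx
      have h1 := gain x hx a z ha (by linarith)
      have h2 := cost x hx a z ha (by linarith)
      have h3 : ε * r x ≤ ε * δ := mul_le_mul_of_nonneg_left hrx.2 hε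
      have h4 : 0 ≤ (L' - L) * (dist a x + dist x z) :=
        mul_nonneg (by linarith) (by positivity)
      linarith
  -- The bounds propagate along an arbitrary jump, at the price of the global Lipschitz constant.
  have step : ∀ y z t, ModificationBound K ψ G r s L' y t →
      ModificationBound K ψ G r s L' z (t + (1 + L') * dist y z) := by
    rintro y z t (h | ⟨x, hx, a, ha, hy, h⟩)
    · left
      have h1 := (abs_le.1 (hG y z)).1
      have h2 : 0 ≤ (L' - L) * dist y z := mul_nonneg (by linarith) dist_nonneg
      linarith
    · have htri := dist_triangle x y z
      by_cases hz : dist x z < r x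
      · right
        refine ⟨x, hx, a, ha, hz, ?_⟩
        have h1 := (abs_le.1 (hψ x hx y z)).1
        have h2 := mul_le_mul_of_nonneg_left htri hL'
        linarith
      · left
        push Not at hz
        have hrx := hr x hx
        have h1 := gain x hx a y ha (by linarith)
        have h2 := cost x hx a y ha (by linarith)
        have h3 := (abs_le.1 (hG y z)).1
        have h4 : 4 * ε * r x ≤ (L' - L) * (dist a x + dist x y + dist y z) := by
          have : r x ≤ dist a x + dist x y + dist y z := by
            linarith [dist_nonneg (x := a) (y := x)]
          exact mul_le_mul hLL' this (by linarith) (by linarith)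
        linarith
  -- They propagate along a short jump from or to `x ∈ K` at the price prescribed by `ψ x`.
  have step' : ∀ y z t x, x ∈ K → (x = y ∨ x = z) → dist y z < s →
      ModificationBound K ψ G r s L' y t →
      ModificationBound K ψ G r s L' z (t + (ψ x z - ψ x y) + L' * dist y z) := by
    rintro y z t x' hx' hxyz hyz (h | ⟨x, hx, a, ha, hy, h⟩)
    · right
      have hrx := hr x' hx'
      refine ⟨x', hx', y, ?_, ?_, ?_⟩
      · rcases hxyz with rfl | rfl <;> simp [hyz, hs]
      · rcases hxyz with rfl | rfl
        · linarith
        · rw [dist_self]; linarith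
      · rcases hxyz with rfl | rfl <;> simp <;> linarith
    · have htri := dist_triangle x y z
      have hrx := hr x hx
      have hxx' : ψ x = ψ x' := by
        apply hψσ x hx x' hx'
        rcases hxyz with rfl | rfl <;> linarith
      rw [← hxx']
      have h2 := mul_le_mul_of_nonneg_left htri hL'
      by_cases hz : dist x z < r x
      · right
        exact ⟨x, hx, a, ha, hz, by linarith⟩
      · left
        push Not at hz
        have h3 := gain x hx a z ha (by linarith)
        have h4 := cost x hx a z ha (by linarith)
        have h5 : 4 * ε * r x ≤ (L' - L) * (dist a x + dist x z) :=
          mul_le_mul hLL' (by linarith [dist_nonneg (x := a) (y := x)]) (by linarith)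
            (by linarith)
        linarith
  set F : X → ℝ := fun z => sInf {t | ModificationBound K ψ G r s L' z t} with hF
  have hbdd : ∀ z, BddBelow {t | ModificationBound K ψ G r s L' z t} :=
    fun z => ⟨_, fun t ht => lower z t ht⟩
  have hne : ∀ z, {t | ModificationBound K ψ G r s L' z t}.Nonempty :=
    fun z => ⟨G z, Or.inl le_rfl⟩
  have hFle : ∀ y z q, (∀ t, ModificationBound K ψ G r s L' y t →
      ModificationBound K ψ G r s L' z (t + q)) → F z ≤ F y + q := by
    intro y z q h
    have : F z - q ≤ F y := le_csInf (hne y) fun t ht => by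
      have := csInf_le (hbdd z) (h t ht)
      simp only [hF]
      linarith
    linarith
  refine ⟨F, fun y z => ?_, fun z => ?_, fun x hx y hxy => ?_⟩
  · have h1 := hFle y z _ (step y z)
    have h2 := hFle z y _ (step z y)
    rw [dist_comm z y] at h2
    exact abs_le.2 ⟨by linarith, by linarith⟩
  · have h1 : F z ≤ G z := csInf_le (hbdd z) (Or.inl le_rfl)
    have h2 : G z - 4 * ε * δ ≤ F z := le_csInf (hne z) (lower z)
    exact abs_le.2 ⟨by linarith, by linarith⟩
  · have h1 := hFle x y (ψ x y - ψ x x + L' * dist x y) fun t ht => by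
      simpa [add_assoc] using step' x y t x hx (Or.inl rfl) hxy ht
    have h2 := hFle y x (ψ x x - ψ x y + L' * dist y x) fun t ht => by
      simpa [add_assoc] using step' y x t x hx (Or.inr rfl) (by rwa [dist_comm]) ht
    rw [dist_comm y x] at h2
    exact abs_le.2 ⟨by linarith, by linarith⟩

/-! ### Lipschitz functions with prescribed increments at alternating scales -/

/-- Iterating `exists_lipschitz_modification` gives one Lipschitz function `f` whose increments from
points `x ∈ K` follow those of `φ n x` at all distances in the window `[T n (s n), s n)`, for every
`n`. The lower end `T n` of the window may be an arbitrary positive function of the scale `s n`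
already reached. -/
theorem exists_lipschitz_prescribed {X : Type*} [MetricSpace X] {K : Set X}
    {φ : ℕ → X → X → ℝ} {l : ℝ} (hl : 0 < l)
    (hφ0 : ∀ x ∈ K, ∀ y, φ 0 x y = φ 0 x x)
    (hφ : ∀ n, ∀ x ∈ K, ∀ y z, |φ n x y - φ n x z| ≤ dist y z)
    (hloc : ∀ n, ∃ σ > 0, ∀ x ∈ K, ∀ x' ∈ K, dist x x' < σ → φ n x = φ n x')
    (hflat : ∀ n, ∀ δ > 0, ∃ s > 0, ∃ r : X → ℝ, ∀ x ∈ K, s ≤ r x ∧ r x ≤ δ ∧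
      ∀ y, dist x y < 2 * r x → |φ n x y - φ n x x| ≤ l * (1 / 2) ^ n / 4 * r x ∧
        |φ (n + 1) x y - φ (n + 1) x x| ≤ l * (1 / 2) ^ n / 4 * r x)
    {T : ℕ → ℝ → ℝ} (hT : ∀ n s, 0 < s → 0 < T n s) :
    ∃ (f : X → ℝ) (s : ℕ → ℝ), (∀ n, 0 < s n ∧ s n ≤ (1 / 2) ^ n) ∧
      (∀ x y, |f x - f y| ≤ (1 + 2 * l) * dist x y) ∧
      ∀ n, ∀ x ∈ K, ∀ y, T n (s n) ≤ dist x y → dist x y < s n →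
        |f y - f x - (φ n x y - φ n x x)| ≤ 4 * l * dist x y := by
  -- The slope allowed at stage `n`; its increments leave room for the slab thickness of that stage.
  set Lc : ℕ → ℝ := fun n => l * (2 - 2 * (1 / 2) ^ n) with hLc
  have hpow : ∀ n : ℕ, (0 : ℝ) < (1 / 2) ^ n := fun n => by positivity
  have hpow1 : ∀ n : ℕ, (1 / 2 : ℝ) ^ n ≤ 1 := fun n => pow_le_one₀ (by norm_num) (by norm_num)
  have hLc0 : ∀ n, 0 ≤ Lc n := fun n => mul_nonneg hl.le (by linarith [hpow1 n])
  have hLc2 : ∀ n, Lc n ≤ 2 * l := fun n => by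
    have := mul_pos hl (hpow n)
    simp only [hLc]; linarith
  -- A stage consists of a function, the scale at which it is controlled near `K`, and a bound for
  -- the last modification.
  let P : ℕ → (X → ℝ) × ℝ × ℝ → Prop := fun n p =>
    (0 < p.2.1 ∧ p.2.1 ≤ (1 / 2) ^ n) ∧ 0 < p.2.2 ∧
      (∀ x y, |p.1 x - p.1 y| ≤ (1 + Lc n) * dist x y) ∧
      ∀ x ∈ K, ∀ y, dist x y < p.2.1 →
        |p.1 y - p.1 x - (φ n x y - φ n x x)| ≤ Lc n * dist x y
  let R : ℕ → (X → ℝ) × ℝ × ℝ → (X → ℝ) × ℝ × ℝ → Prop := fun n p p' =>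
    2 * p'.2.2 ≤ p.2.2 ∧ 2 * p'.2.2 ≤ l * T n p.2.1 ∧ ∀ x, |p'.1 x - p.1 x| ≤ p'.2.2
  have hstep : ∀ n p, P n p → ∃ p', P (n + 1) p' ∧ R n p p' := by
    rintro n ⟨G, s₀, κ⟩ ⟨⟨hs₀, -⟩, hκ, hG, hGφ⟩
    dsimp only at hs₀ hκ hG hGφ
    obtain ⟨σ, hσ, hloc⟩ := hloc (n + 1)
    have hTn := mul_pos hl (hT n s₀ hs₀)
    set κ' := min (κ / 2) (l * T n s₀ / 2) with hκ'
    have hκ'0 : 0 < κ' := lt_min (by linarith) (by linarith)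
    have hln := mul_pos hl (hpow n)
    obtain ⟨δ, hδ, hδ1, hδ2, hδ3⟩ : ∃ δ > 0, 2 * δ ≤ s₀ ∧ 2 * δ ≤ σ ∧
        4 * (l * (1 / 2) ^ n / 4) * δ ≤ κ' := by
      refine ⟨min (min (s₀ / 2) (σ / 2)) (κ' / (l * (1 / 2) ^ n)), by positivity, ?_, ?_, ?_⟩
      · linarith [(min_le_left (min (s₀ / 2) (σ / 2)) (κ' / (l * (1 / 2) ^ n))).trans
          (min_le_left _ _)]
      · linarith [(min_le_left (min (s₀ / 2) (σ / 2)) (κ' / (l * (1 / 2) ^ n))).trans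
          (min_le_right _ _)]
      · have h := min_le_right (min (s₀ / 2) (σ / 2)) (κ' / (l * (1 / 2) ^ n))
        rw [le_div_iff₀ hln] at h
        linarith
    obtain ⟨s, hs, r, hr⟩ := hflat n δ hδ
    obtain ⟨F, hF, hFG, hFφ⟩ := exists_lipschitz_modification (L := Lc n) (L' := Lc (n + 1))
      (hLc0 n) (by positivity) hδ.le (by simp only [hLc, pow_succ]; linarith) hG hGφ (hφ (n + 1))
      hloc (fun x hx => ⟨(hr x hx).1, (hr x hx).2.1⟩) hs
      (fun x hx y hy => ((hr x hx).2.2 y hy).1) (fun x hx y hy => ((hr x hx).2.2 y hy).2) hδ1 hδ2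
    refine ⟨⟨F, min s ((1 / 2) ^ (n + 1)), κ'⟩, ⟨⟨lt_min hs (hpow _), min_le_right _ _⟩, hκ'0, hF,
      fun x hx y hy => hFφ x hx y (hy.trans_le (min_le_left _ _))⟩, ?_, ?_, ?_⟩
    · change 2 * κ' ≤ κ
      linarith [min_le_left (κ / 2) (l * T n s₀ / 2)]
    · change 2 * κ' ≤ l * T n s₀
      linarith [min_le_right (κ / 2) (l * T n s₀ / 2)]
    · exact fun x => (hFG x).trans hδ3
  choose! next hnext using hstep
  set q : ℕ → (X → ℝ) × ℝ × ℝ := fun n => Nat.rec (0, 1, 1) next n with hq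
  have hq0 : (q 0).1 = fun _ => 0 := rfl
  have hP : ∀ n, P n (q n) := by
    intro n
    induction n with
    | zero =>
      refine ⟨⟨one_pos, by simp [hq]⟩, one_pos, fun x y => ?_, fun x hx y _ => ?_⟩
      · rw [hq0, sub_self, abs_zero]
        exact mul_nonneg (by linarith [hLc0 0]) dist_nonneg
      · rw [hq0, hφ0 x hx y, sub_self, sub_self, sub_self, abs_zero]
        exact mul_nonneg (hLc0 0) dist_nonneg
    | succ n ih => exact (hnext n _ ih).1
  have hR : ∀ n, R n (q n) (q (n + 1)) := fun n => (hnext n _ (hP n)).2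
  have hclose : ∀ x n k, |(q (n + k)).1 x - (q n).1 x| ≤
      2 * (q (n + 1)).2.2 - 2 * (q (n + k + 1)).2.2 := by
    intro x n k
    induction k with
    | zero => simp
    | succ k ih =>
      have h1 := (hR (n + k)).2.2 x
      have h2 := (hR (n + k + 1)).1
      have h3 := abs_sub_le ((q (n + k + 1)).1 x) ((q (n + k)).1 x) ((q n).1 x)
      rw [← add_assoc]
      linarith
  have hκ : ∀ n, (q n).2.2 ≤ (1 / 2) ^ n := by
    intro n
    induction n with
    | zero => simp [hq]
    | succ n ih =>
      have := (hR n).1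
      rw [pow_succ]
      linarith
  have hlim : ∀ x, ∃ a, Tendsto (fun n => (q n).1 x) atTop (𝓝 a) := by
    intro x
    refine cauchySeq_tendsto_of_complete (cauchySeq_of_le_geometric_two (C := 1) fun n => ?_)
    have h1 := (hR n).2.2 x
    have h2 := hκ (n + 1)
    rw [dist_comm, Real.dist_eq]
    refine (h1.trans h2).trans (le_of_eq ?_)
    rw [pow_succ, one_div, inv_pow]
    field_simp
  choose f hf using hlim
  have hfq : ∀ n x, |f x - (q n).1 x| ≤ l * T n (q n).2.1 := by
    intro n x
    have h1 : Tendsto (fun k => |(q (n + k)).1 x - (q n).1 x|) atTop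
        (𝓝 |f x - (q n).1 x|) := by
      refine ((Tendsto.sub_const ?_ _).abs)
      simpa only [add_comm n] using (tendsto_add_atTop_iff_nat n).2 (hf x)
    refine le_of_tendsto' h1 fun k => ?_
    have h2 := (hP (n + k + 1)).2.1
    linarith [hclose x n k, (hR n).2.1]
  refine ⟨f, fun n => (q n).2.1, fun n => (hP n).1, fun x y => ?_, fun n x hx y h1 h2 => ?_⟩
  · refine le_of_tendsto' ((hf x).sub (hf y)).abs fun n => ((hP n).2.2.1 x y).trans ?_
    exact mul_le_mul_of_nonneg_right (by linarith [hLc2 n]) dist_nonneg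
  · have h3 := abs_le.1 (hfq n x)
    have h4 := abs_le.1 (hfq n y)
    have h5 := abs_le.1 ((hP n).2.2.2 x hx y h2)
    have h6 : Lc n * dist x y ≤ 2 * l * dist x y :=
      mul_le_mul_of_nonneg_right (hLc2 n) dist_nonneg
    have h7 : l * T n (q n).2.1 ≤ l * dist x y := mul_le_mul_of_nonneg_left h1 hl.le
    exact abs_le.2 ⟨by linarith, by linarith⟩

/-! ### Flat and steep points, compact selections, and directions -/

/-- At arbitrarily small scales `r`, the oscillation of `g` on the ball of radius `2 * r` around `x`
is smaller than `ε * r`. The strict inequality `ε' < ε` makes the condition at a bounded scale open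
in `x`. -/
def FlatAt {X : Type*} [MetricSpace X] (g : X → ℝ) (ε : ℝ) (x : X) : Prop :=
  ∀ δ > 0, ∃ r > 0, r < δ ∧ ∃ ε' < ε, ∀ y, dist x y < 2 * r → |g y - g x| ≤ ε' * r

/-- There are points `y` arbitrarily close to `x` from which `g` has slope larger than `c`. -/
def SteepAt {X : Type*} [MetricSpace X] (g : X → ℝ) (c : ℝ) (x : X) : Prop :=
  ∀ δ > 0, ∃ y, 0 < dist x y ∧ dist x y < δ ∧ c * dist x y < |g y - g x|

theorem setOf_eq_iInter_nat {X : Type*} {p : X → ℝ → Prop}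
    (hp : ∀ x δ δ', δ ≤ δ' → p x δ → p x δ') :
    {x | ∀ δ > 0, p x δ} = ⋂ m : ℕ, {x | p x (1 / (m + 1 : ℝ))} := by
  ext x
  simp only [Set.mem_ofPred_eq, Set.mem_iInter]
  refine ⟨fun h m => h _ (by positivity), fun h δ hδ => ?_⟩
  obtain ⟨m, hm⟩ := exists_nat_one_div_lt hδ
  exact hp _ _ _ hm.le (h m)

theorem measurableSet_flatAt {X : Type*} [MetricSpace X] [MeasurableSpace X] [BorelSpace X]
    {g : X → ℝ} (hg : ∀ x y, |g x - g y| ≤ dist x y) {ε : ℝ} :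
    MeasurableSet {x | FlatAt g ε x} := by
  have : {x | FlatAt g ε x} = _ := setOf_eq_iInter_nat
    (p := fun x δ => ∃ r > 0, r < δ ∧ ∃ ε' < ε, ∀ y, dist x y < 2 * r → |g y - g x| ≤ ε' * r)
    (fun x δ δ' h ⟨r, h0, h1, h2⟩ => ⟨r, h0, h1.trans_le h, h2⟩)
  rw [this]
  refine MeasurableSet.iInter fun m => IsOpen.measurableSet (Metric.isOpen_iff.2 ?_)
  rintro x ⟨r, hr, hrm, ε', hε', h⟩
  have hε'0 : 0 ≤ ε' := by
    have := (abs_nonneg _).trans (h x (by simpa using hr))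
    nlinarith
  -- At a point at distance less than `t` the radius `r - t` works with the constant `ε''`.
  set ε'' := (ε' + ε) / 2 with hε''
  set t := min (r / 2) ((ε'' - ε') * r / (2 + ε'')) with ht
  have ht0 : 0 < t := lt_min (by linarith) (div_pos (mul_pos (by linarith) hr) (by linarith))
  have ht1 : t ≤ r / 2 := min_le_left _ _
  have ht2 : t * (2 + ε'') ≤ (ε'' - ε') * r := by
    rw [← le_div_iff₀ (by linarith)]; exact min_le_right _ _
  refine ⟨t, ht0, fun x' hx' => ⟨r - t, by linarith, by linarith, ε'', by linarith, ?_⟩⟩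
  intro y hy
  rw [Metric.mem_ball] at hx'
  have hx'' := hx'
  rw [dist_comm] at hx''
  have h1 := abs_le.1 (h y (by linarith [dist_triangle x x' y]))
  have h2 := abs_le.1 (hg x x')
  exact abs_le.2 ⟨by linarith, by linarith⟩

theorem measurableSet_steepAt {X : Type*} [MetricSpace X] [MeasurableSpace X] [BorelSpace X]
    {g : X → ℝ} (hg : Continuous g) {c : ℝ} :
    MeasurableSet {x | SteepAt g c x} := by
  have : {x | SteepAt g c x} = _ := setOf_eq_iInter_nat
    (p := fun x δ => ∃ y, 0 < dist x y ∧ dist x y < δ ∧ c * dist x y < |g y - g x|)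
    (fun x δ δ' h ⟨r, h0, h1, h2⟩ => ⟨r, h0, h1.trans_le h, h2⟩)
  rw [this]
  refine MeasurableSet.iInter fun m => IsOpen.measurableSet ?_
  simp only [Set.ofPred_exists]
  refine isOpen_iUnion fun y => ?_
  have h1 : IsOpen {x | 0 < dist x y} := isOpen_lt (by fun_prop) (by fun_prop)
  have h2 : IsOpen {x | dist x y < 1 / (m + 1 : ℝ)} := isOpen_lt (by fun_prop) (by fun_prop)
  have h3 : IsOpen {x | c * dist x y < |g y - g x|} := isOpen_lt (by fun_prop) (by fun_prop)
  exact h1.inter (h2.inter h3)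

/-- On a compact set, flatness with locally constant data holds at scales bounded away from `0`,
with a worse constant. -/
theorem IsCompact.exists_uniform_flat_scale {X : Type*} [MetricSpace X] {K : Set X}
    (hK : IsCompact K) {g : X → X → ℝ} {ε σ : ℝ} (hσ : 0 < σ) (hε : 0 < ε)
    (hg : ∀ x ∈ K, ∀ y z, |g x y - g x z| ≤ dist y z)
    (hgσ : ∀ x ∈ K, ∀ x' ∈ K, dist x x' < σ → g x = g x')
    (hflat : ∀ x ∈ K, FlatAt (g x) ε x) {δ : ℝ} (hδ : 0 < δ) :
    ∃ s > 0, ∃ r : X → ℝ, ∀ x ∈ K, s ≤ r x ∧ r x ≤ δ ∧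
      ∀ y, dist x y < 2 * r x → |g x y - g x x| ≤ 4 * ε * r x := by
  suffices h : ∃ s > 0, ∀ x ∈ K, x ∈ K → ∃ r, s ≤ r ∧ r ≤ δ ∧
      ∀ y, dist x y < 2 * r → |g x y - g x x| ≤ 4 * ε * r by
    obtain ⟨s, hs, h⟩ := h
    have h' : ∀ x ∈ K, ∃ r, s ≤ r ∧ r ≤ δ ∧
      ∀ y, dist x y < 2 * r → |g x y - g x x| ≤ 4 * ε * r := fun x hx => h x hx hx
    choose! r hr using h'
    exact ⟨s, hs, r, hr⟩
  refine hK.induction_on (p := fun S => ∃ s > 0, ∀ x ∈ S, x ∈ K → ∃ r, s ≤ r ∧ r ≤ δ ∧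
      ∀ y, dist x y < 2 * r → |g x y - g x x| ≤ 4 * ε * r) ⟨1, one_pos, by simp⟩ ?_ ?_ ?_
  · rintro S S' hS ⟨s, hs, h⟩
    exact ⟨s, hs, fun x hx => h x (hS hx)⟩
  · rintro S S' ⟨s, hs, h⟩ ⟨s', hs', h'⟩
    refine ⟨min s s', lt_min hs hs', ?_⟩
    rintro x (hx | hx) hxK
    · obtain ⟨r, h1, h2⟩ := h x hx hxK
      exact ⟨r, (min_le_left _ _).trans h1, h2⟩
    · obtain ⟨r, h1, h2⟩ := h' x hx hxK
      exact ⟨r, (min_le_right _ _).trans h1, h2⟩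
  · intro x hx
    obtain ⟨r, hr, hrδ, ε', hε', h⟩ := hflat x hx δ hδ
    refine ⟨Metric.ball x (min (min (ε * r) r) σ), mem_nhdsWithin_of_mem_nhds
      (Metric.ball_mem_nhds _ (by positivity)), r / 2, by linarith, fun x' hx' hx'K =>
      ⟨r / 2, le_rfl, by linarith, fun y hy => ?_⟩⟩
    rw [Metric.mem_ball, dist_comm, lt_min_iff, lt_min_iff] at hx'
    obtain ⟨⟨h1, h2⟩, h3⟩ := hx'
    rw [← hgσ x hx x' hx'K h3]
    have h4 := abs_le.1 (h y (by linarith [dist_triangle x x' y]))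
    have h5 := abs_le.1 (hg x hx x x')
    have h6 : ε' * r ≤ ε * r := mul_le_mul_of_nonneg_right hε'.le hr.le
    exact abs_le.2 ⟨by linarith, by linarith⟩

/-- A Lusin-type selection: from countably many measurable sets covering almost everything one can
choose, on a compact set of almost full measure, an index that is locally constant at a uniform
scale. -/
theorem exists_isCompact_locally_constant_selection {X : Type*} [MetricSpace X]
    [MeasurableSpace X] [BorelSpace X] (ν : Measure X) [IsFiniteMeasure ν]
    [ν.InnerRegularCompactLTTop] {W : ℕ → Set X} (hW : ∀ i, MeasurableSet (W i))
    (hcov : ν (⋃ i, W i)ᶜ = 0) {β : ℝ≥0∞} (hβ : β ≠ 0) :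
    ∃ K : Set X, IsCompact K ∧ ν Kᶜ ≤ β ∧ ∃ (i : X → ℕ) (σ : ℝ), 0 < σ ∧
      (∀ x ∈ K, x ∈ W (i x)) ∧ ∀ x ∈ K, ∀ x' ∈ K, dist x x' < σ → i x = i x' := by
  have hβ2 : β / 2 ≠ 0 := (ENNReal.div_pos hβ (by finiteness)).ne'
  obtain ⟨k, hk⟩ : ∃ k : ℕ, ν (⋃ j < k, W j)ᶜ < β / 2 := by
    have hanti : Antitone fun k : ℕ => (⋃ j < k, W j)ᶜ := fun a b hab =>
      Set.compl_subset_compl.2 (Set.biUnion_subset_biUnion_left fun j hj => lt_of_lt_of_le hj hab)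
    have h := tendsto_measure_iInter_atTop (μ := ν)
      (fun k => (MeasurableSet.iUnion fun j => MeasurableSet.iUnion fun (_ : j < k) =>
        hW j).compl.nullMeasurableSet) hanti ⟨0, measure_ne_top _ _⟩
    have h0 : ν (⋂ k : ℕ, (⋃ j < k, W j)ᶜ) = 0 := by
      refine measure_mono_null (fun x hx => ?_) hcov
      simp only [Set.mem_iInter, Set.mem_compl_iff, Set.mem_iUnion, not_exists] at hx ⊢
      exact fun j => hx (j + 1) j (Nat.lt_succ_self j)
    rw [h0] at h
    exact (h.eventually_lt_const (pos_iff_ne_zero.2 hβ2)).exists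
  -- Disjoint measurable pieces, each exhausted by a compact set; disjoint compact sets are at
  -- positive distance from each other.
  set P : ℕ → Set X := fun j => W j \ ⋃ i < j, W i with hP
  have hPm : ∀ j, MeasurableSet (P j) := fun j => (hW j).diff
    (MeasurableSet.iUnion fun i => MeasurableSet.iUnion fun _ => hW i)
  have hPd : ∀ j j', j ≠ j' → Disjoint (P j) (P j') := by
    intro j j' hne
    refine Set.disjoint_left.2 fun x hx hx' => ?_
    rcases hne.lt_or_gt with h | h
    · exact hx'.2 (Set.mem_biUnion h hx.1)
    · exact hx.2 (Set.mem_biUnion h hx'.1)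
  have hC : ∀ j, ∃ C ⊆ P j, IsCompact C ∧ ν (P j \ C) < β / 2 / (k + 1) := fun j =>
    (hPm j).exists_isCompact_sdiff_lt (measure_ne_top _ _)
      (ENNReal.div_pos hβ2 (by finiteness)).ne'
  choose C hCP hCc hCν using hC
  have hsep : ∀ j j', ∃ σ > 0, j ≠ j' → ∀ x ∈ C j, ∀ x' ∈ C j', σ ≤ dist x x' := by
    intro j j'
    by_cases h : j = j'
    · exact ⟨1, one_pos, fun h' => absurd h h'⟩
    obtain ⟨σ, hσ, hd⟩ := ((hPd j j' h).mono (hCP j) (hCP j')).exists_thickenings (hCc j)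
      (hCc j').isClosed
    refine ⟨σ, hσ, fun _ x hx x' hx' => ?_⟩
    by_contra! hlt
    exact Set.disjoint_left.1 hd (Metric.self_subset_thickening hσ _ hx)
      (Metric.mem_thickening_iff.2 ⟨x', hx', hlt⟩)
  choose τ hτ hsep using hsep
  obtain ⟨σ, hσ, hστ⟩ : ∃ σ > 0, ∀ j < k, ∀ j' < k, σ ≤ τ j j' := by
    have : ∀ F : Finset (ℕ × ℕ), ∃ σ > 0, ∀ p ∈ F, σ ≤ τ p.1 p.2 := by
      intro F
      induction F using Finset.induction_on with
      | empty => exact ⟨1, one_pos, by simp⟩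
      | insert p F _ ih =>
        obtain ⟨σ, hσ, h⟩ := ih
        refine ⟨min σ (τ p.1 p.2), lt_min hσ (hτ _ _), fun p' hp' => ?_⟩
        rcases Finset.mem_insert.1 hp' with rfl | hp'
        · exact min_le_right _ _
        · exact (min_le_left _ _).trans (h p' hp')
    obtain ⟨σ, hσ, h⟩ := this (Finset.range k ×ˢ Finset.range k)
    exact ⟨σ, hσ, fun j hj j' hj' => h (j, j') (by simp [hj, hj'])⟩
  have hmem : ∀ x ∈ ⋃ j < k, C j, ∃ j, j < k ∧ x ∈ C j := fun x hx => by
    simpa using hx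
  choose! i hik hiC using hmem
  refine ⟨⋃ j < k, C j, (Set.finite_lt_nat k).isCompact_biUnion fun j _ => hCc j, ?_, i, σ, hσ,
    fun x hx => (hCP _ (hiC x hx)).1, fun x hx x' hx' h => ?_⟩
  · have hsub : (⋃ j < k, C j)ᶜ ⊆ (⋃ j < k, W j)ᶜ ∪ ⋃ j ∈ Finset.range k, P j \ C j := by
      intro x hx
      by_cases hxW : x ∈ ⋃ j < k, W j
      · right
        classical
        have hex : ∃ j, j < k ∧ x ∈ W j := by simpa using hxW
        have hj := Nat.find_spec hex
        refine Set.mem_biUnion (Finset.mem_range.2 hj.1) ⟨⟨hj.2, fun hlt => ?_⟩, fun hxC =>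
          hx (Set.mem_biUnion hj.1 hxC)⟩
        obtain ⟨j', hj', hxj'⟩ : ∃ j', j' < Nat.find hex ∧ x ∈ W j' := by simpa using hlt
        exact Nat.find_min hex hj' ⟨hj'.trans hj.1, hxj'⟩
      · exact Or.inl hxW
    calc ν (⋃ j < k, C j)ᶜ ≤ ν (⋃ j < k, W j)ᶜ + ∑ j ∈ Finset.range k, ν (P j \ C j) :=
          (measure_mono hsub).trans ((measure_union_le _ _).trans
            (add_le_add le_rfl (measure_biUnion_finset_le _ _)))
      _ ≤ β / 2 + ∑ j ∈ Finset.range k, β / 2 / (k + 1) :=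
          add_le_add hk.le (Finset.sum_le_sum fun j _ => (hCν j).le)
      _ ≤ β / 2 + β / 2 := by
          refine add_le_add le_rfl ?_
          rw [Finset.sum_const, Finset.card_range, nsmul_eq_mul]
          calc (k : ℝ≥0∞) * (β / 2 / (k + 1)) ≤ (k + 1) * (β / 2 / (k + 1)) := by
                gcongr; exact le_self_add
            _ ≤ β / 2 := ENNReal.mul_div_le
      _ = β := ENNReal.add_halves β
  · by_contra hne
    exact absurd h (not_lt.2 ((hστ _ (hik x hx) _ (hik x' hx')).trans
      (hsep _ _ hne x (hiC x hx) x' (hiC x' hx'))))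

/-- Off a set of small measure, every direction in which `ξ` leaves `x` at distances less than `s` is
also taken, up to `θ`, at some distance in a fixed window `[τ, s)`. -/
theorem exists_direction_window {X : Type*} [MetricSpace X]
    [MeasurableSpace X] [BorelSpace X] (ν : Measure X) [IsFiniteMeasure ν]
    {E : Type*} [NormedAddCommGroup E] [NormedSpace ℝ E] [ProperSpace E] {ξ : X → E}
    (hξ : ∀ x y, ‖ξ y - ξ x‖ ≤ dist x y) (s : ℝ) {θ : ℝ} (hθ : 0 < θ)
    {β : ℝ≥0∞} (hβ : β ≠ 0) :
    ∃ τ > 0, ∃ B, MeasurableSet B ∧ ν B ≤ β ∧ ∀ x ∉ B, ∀ y, 0 < dist x y → dist x y < s →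
      ∃ q : E, ‖ξ y - ξ x - dist x y • q‖ < θ * dist x y ∧
        ∃ y', τ ≤ dist x y' ∧ dist x y' < s ∧
          ‖ξ y' - ξ x - dist x y' • q‖ < θ * dist x y' := by
  obtain ⟨t, -, htf, ht⟩ := (isCompact_closedBall (0 : E) 1).finite_cover_balls hθ
  -- The points from which direction `q` is taken at a distance in `(τ, s)`.
  set O : E → ℝ → Set X := fun q τ =>
    {x | ∃ y, τ < dist x y ∧ dist x y < s ∧ ‖ξ y - ξ x - dist x y • q‖ < θ * dist x y} with hO
  have hξc : Continuous ξ := by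
    have : LipschitzWith 1 ξ := LipschitzWith.of_dist_le_mul fun x y => by
      rw [dist_comm, dist_eq_norm, NNReal.coe_one, one_mul]; exact hξ x y
    exact this.continuous
  have hOo : ∀ q τ, IsOpen (O q τ) := by
    intro q τ
    simp only [hO, Set.ofPred_exists]
    refine isOpen_iUnion fun y => ?_
    have h1 : IsOpen {x | τ < dist x y} := isOpen_lt (by fun_prop) (by fun_prop)
    have h2 : IsOpen {x | dist x y < s} := isOpen_lt (by fun_prop) (by fun_prop)
    have h3 : IsOpen {x | ‖ξ y - ξ x - dist x y • q‖ < θ * dist x y} :=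
      isOpen_lt (by fun_prop) (by fun_prop)
    exact h1.inter (h2.inter h3)
  set D : E → ℕ → Set X := fun q m => O q 0 \ O q (1 / (m + 1 : ℝ)) with hD
  have hDm : ∀ q m, MeasurableSet (D q m) := fun q m =>
    (hOo _ _).measurableSet.diff (hOo _ _).measurableSet
  have hD0 : ∀ q, Tendsto (fun m => ν (D q m)) atTop (𝓝 0) := by
    intro q
    have hanti : Antitone (D q) := by
      rintro a b hab x ⟨hx, hx'⟩
      refine ⟨hx, fun ⟨y, h1, h2⟩ => hx' ⟨y, lt_of_le_of_lt ?_ h1, h2⟩⟩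
      exact Nat.one_div_le_one_div hab
    have h := tendsto_measure_iInter_atTop (μ := ν)
      (fun m => (hDm q m).nullMeasurableSet) hanti ⟨0, measure_ne_top _ _⟩
    have h0 : ⋂ m, D q m = ∅ := by
      refine Set.eq_empty_of_forall_notMem fun x hx => ?_
      rw [Set.mem_iInter] at hx
      obtain ⟨y, h1, h2⟩ := (hx 0).1
      obtain ⟨m, hm⟩ := exists_nat_one_div_lt h1
      exact (hx m).2 ⟨y, hm, h2⟩
    rwa [h0, measure_empty] at h
  have hsum : Tendsto (fun m => ∑ q ∈ htf.toFinset, ν (D q m)) atTop (𝓝 0) := by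
    simpa using tendsto_finsetSum htf.toFinset fun q _ => hD0 q
  obtain ⟨m, hm⟩ := (hsum.eventually_lt_const (pos_iff_ne_zero.2 hβ)).exists
  refine ⟨1 / (m + 1 : ℝ), by positivity, ⋃ q ∈ htf.toFinset, D q m,
    Finset.measurableSet_biUnion _ fun q _ => hDm q m,
    (measure_biUnion_finset_le _ _).trans hm.le, fun x hx y hy hys => ?_⟩
  have hmem : (dist x y)⁻¹ • (ξ y - ξ x) ∈ Metric.closedBall (0 : E) 1 := by
    rw [mem_closedBall_zero_iff, norm_smul, norm_inv, Real.norm_of_nonneg hy.le]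
    exact inv_mul_le_one_of_le₀ (hξ x y) hy.le
  obtain ⟨q, hq, hqy⟩ := Set.mem_iUnion₂.1 (ht hmem)
  have hqy' : ‖ξ y - ξ x - dist x y • q‖ < θ * dist x y := by
    have h1 : ξ y - ξ x - dist x y • q =
        dist x y • ((dist x y)⁻¹ • (ξ y - ξ x) - q) := by
      rw [smul_sub, smul_inv_smul₀ hy.ne']
    rw [h1, norm_smul, Real.norm_of_nonneg hy.le, mul_comm]
    rw [Metric.mem_ball, dist_eq_norm] at hqy
    exact mul_lt_mul_of_pos_right hqy hy
  refine ⟨q, hqy', ?_⟩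
  have hxO : x ∈ O q 0 := ⟨y, hy, hys, hqy'⟩
  by_contra hcon
  refine hx (Set.mem_biUnion (htf.mem_toFinset.2 hq) ⟨hxO, fun ⟨y', h1, h2, h3⟩ => hcon ?_⟩)
  exact ⟨y', h1.le, h2, h3⟩

/-! ### A Lipschitz function that is not differentiable -/

/-- A bound for the slope of a linear function towards `y'` carries over to any `y` lying in nearly
the same direction `q` from `x`. -/
theorem abs_inner_sub_le_of_common_direction {X E : Type*} [MetricSpace X] [NormedAddCommGroup E]
    [InnerProductSpace ℝ E] {ξ : X → E} {x y y' : X} {u q : E} {θ a : ℝ}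
    (hy' : 0 < dist x y')
    (hq : ‖ξ y - ξ x - dist x y • q‖ ≤ θ * dist x y)
    (hq' : ‖ξ y' - ξ x - dist x y' • q‖ ≤ θ * dist x y')
    (hu : |inner ℝ u (ξ y' - ξ x)| ≤ a * dist x y') :
    |inner ℝ u (ξ y - ξ x)| ≤ (a + 2 * θ * ‖u‖) * dist x y := by
  have key : ∀ z, ‖ξ z - ξ x - dist x z • q‖ ≤ θ * dist x z →
      |inner ℝ u (ξ z - ξ x) - dist x z * inner ℝ u q| ≤ ‖u‖ * (θ * dist x z) := by
    intro z hz
    rw [← real_inner_smul_right, ← inner_sub_right]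
    exact (abs_real_inner_le_norm _ _).trans (mul_le_mul_of_nonneg_left hz (norm_nonneg _))
  have h1 := key y hq
  have h2 := key y' hq'
  have h3 : |inner ℝ u q| ≤ a + θ * ‖u‖ := by
    have h4 : dist x y' * |inner ℝ u q| ≤ dist x y' * (a + θ * ‖u‖) := by
      rw [← abs_of_pos hy', ← abs_mul, abs_of_pos hy']
      have := abs_sub_abs_le_abs_sub (dist x y' * inner ℝ u q) (inner ℝ u (ξ y' - ξ x))
      rw [abs_sub_comm] at this
      linarith
    exact le_of_mul_le_mul_left h4 hy'
  have h5 := abs_sub_abs_le_abs_sub (inner ℝ u (ξ y - ξ x)) (dist x y * inner ℝ u q)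
  rw [abs_mul, abs_of_nonneg (dist_nonneg (x := x) (y := y))] at h5
  have h6 := mul_le_mul_of_nonneg_left h3 (dist_nonneg (x := x) (y := y))
  linarith

theorem HasDifferentialAt.eventually_abs_sub_le {X : Type*} [MetricSpace X] {N : ℕ}
    {ξ : X → EuclideanSpace ℝ (Fin N)} {f : X → ℝ} {w : EuclideanSpace ℝ (Fin N)} {x : X}
    (h : HasDifferentialAt ξ f w x) {a : ℝ} (ha : 0 < a) :
    ∃ ρ > 0, ∀ y, dist x y < ρ → |f y - f x - inner ℝ w (ξ y - ξ x)| ≤ a * dist x y := by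
  have hev := h.eventually_lt_const ha
  rw [eventually_nhdsWithin_iff, Metric.eventually_nhds_iff] at hev
  obtain ⟨ρ, hρ, hev⟩ := hev
  refine ⟨ρ, hρ, fun y hy => ?_⟩
  by_cases hxy : y = x
  · simp [hxy]
  have h3 := hev (by rwa [dist_comm]) hxy
  rw [div_lt_iff₀ (dist_pos.2 (Ne.symm hxy))] at h3
  exact h3.le

/-- If at every point of `Z` some linear function of `ξ` has vanishing lower and uniformly positive
upper pointwise Lipschitz constant, then some Lipschitz function is non-differentiable on a part of
`Z` of positive outer measure. The set `Z` need not be measurable; measure-theoretic choices are made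
for `μ.restrict Z`. -/
theorem exists_lipschitz_not_differentiable {X : Type*} [MetricSpace X] [MeasurableSpace X]
    [BorelSpace X] {N : ℕ} (μ : Measure X) [μ.InnerRegularCompactLTTop]
    {ξ : X → EuclideanSpace ℝ (Fin N)} (hξ : ∀ x y, ‖ξ y - ξ x‖ ≤ dist x y)
    {Z : Set X} (hZ0 : μ Z ≠ 0) (hZtop : μ Z ≠ ⊤) {c : ℝ} (hc : 0 < c)
    (hZ : ∀ x ∈ Z, ∃ v : EuclideanSpace ℝ (Fin N), ‖v‖ ≤ 1 ∧
      (∀ ε > 0, FlatAt (fun y => inner ℝ v (ξ y)) ε x) ∧ SteepAt (fun y => inner ℝ v (ξ y)) c x) :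
    ∃ f : X → ℝ, (∃ K : ℝ≥0, LipschitzWith K f) ∧
      μ {x | x ∈ Z ∧ ∀ w, ¬ HasDifferentialAt ξ f w x} ≠ 0 := by
  set ν := μ.restrict Z with hν
  have : IsFiniteMeasure ν := isFiniteMeasure_restrict.2 hZtop
  have hνu : ν Set.univ ≠ 0 := by rwa [hν, Measure.restrict_apply_univ]
  have hinner : ∀ v : EuclideanSpace ℝ (Fin N), ‖v‖ ≤ 1 → ∀ x y,
      |inner ℝ v (ξ x) - inner ℝ v (ξ y)| ≤ dist x y := by
    intro v hv x y
    rw [← inner_sub_right, dist_comm]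
    refine (abs_real_inner_le_norm _ _).trans ?_
    exact (mul_le_mul hv (hξ y x) (norm_nonneg _) zero_le_one).trans (one_mul _).le
  set l := c / 24 with hl
  have hl0 : 0 < l := by positivity
  have hpow : ∀ n : ℕ, (0 : ℝ) < (1 / 2) ^ n := fun n => by positivity
  set e : ℕ → ℝ := fun n => l * (1 / 2) ^ n / 16 with he
  have he0 : ∀ n, 0 < e n := fun n => by have := hpow n; positivity
  have : Nonempty (Metric.closedBall (0 : EuclideanSpace ℝ (Fin N)) 1) := ⟨⟨0, by simp⟩⟩
  -- A countable dense set of vectors replaces the possibly non-measurable choice of `v` in `hZ`.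
  set V : ℕ → EuclideanSpace ℝ (Fin N) := fun i =>
    (TopologicalSpace.denseSeq (Metric.closedBall (0 : EuclideanSpace ℝ (Fin N)) 1) i).1 with hV
  have hV1 : ∀ i, ‖V i‖ ≤ 1 := fun i => mem_closedBall_zero_iff.1 (Subtype.prop _)
  have hVd : ∀ v : EuclideanSpace ℝ (Fin N), ‖v‖ ≤ 1 → ∀ ρ > 0, ∃ i, ‖V i - v‖ < ρ := by
    intro v hv ρ hρ
    obtain ⟨i, hi⟩ := (TopologicalSpace.denseRange_denseSeq
      (Metric.closedBall (0 : EuclideanSpace ℝ (Fin N)) 1)).exists_dist_lt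
      ⟨v, mem_closedBall_zero_iff.2 hv⟩ hρ
    refine ⟨i, ?_⟩
    rw [← dist_eq_norm, dist_comm]
    exact hi
  set W : ℕ → ℕ → Set X := fun n i =>
    {x | FlatAt (fun y => inner ℝ (V i) (ξ y)) (e n) x} ∩
      {x | SteepAt (fun y => inner ℝ (V i) (ξ y)) (c / 2) x} with hW
  have hWm : ∀ n i, MeasurableSet (W n i) := by
    intro n i
    refine (measurableSet_flatAt (hinner _ (hV1 i))).inter (measurableSet_steepAt ?_)
    exact (LipschitzWith.of_dist_le_mul (K := 1) fun x y => by
      rw [NNReal.coe_one, one_mul]; exact hinner _ (hV1 i) x y).continuous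
  have hWZ : ∀ n, Z ⊆ ⋃ i, W n i := by
    intro n x hx
    obtain ⟨v, hv, hflat, hsteep⟩ := hZ x hx
    obtain ⟨i, hi⟩ := hVd v hv (min (e n / 4) (c / 2)) (lt_min (by linarith [he0 n]) (by linarith))
    have hdiff : ∀ y, |(inner ℝ (V i) (ξ y) - inner ℝ (V i) (ξ x)) -
        (inner ℝ v (ξ y) - inner ℝ v (ξ x))| ≤ min (e n / 4) (c / 2) * dist x y := by
      intro y
      rw [← inner_sub_right, ← inner_sub_right, ← inner_sub_left]
      exact (abs_real_inner_le_norm _ _).trans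
        (mul_le_mul hi.le (hξ x y) (norm_nonneg _) ((norm_nonneg _).trans hi.le))
    refine Set.mem_iUnion.2 ⟨i, fun δ hδ => ?_, fun δ hδ => ?_⟩
    · obtain ⟨r, hr, hrδ, ε', hε', h⟩ := hflat (e n / 2) (by linarith [he0 n]) δ hδ
      refine ⟨r, hr, hrδ, ε' + e n / 2, by linarith, fun y hy => ?_⟩
      have h1 := abs_le.1 (h y hy)
      have h2 := abs_le.1 (hdiff y)
      have h3 : min (e n / 4) (c / 2) * dist x y ≤ e n / 4 * (2 * r) :=
        mul_le_mul (min_le_left _ _) hy.le dist_nonneg (by linarith [he0 n])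
      exact abs_le.2 ⟨by linarith, by linarith⟩
    · obtain ⟨y, h0, hy, h⟩ := hsteep δ hδ
      refine ⟨y, h0, hy, ?_⟩
      have h2 := (hdiff y).trans (mul_le_mul_of_nonneg_right (min_le_right _ _) dist_nonneg)
      rw [abs_sub_comm] at h2
      have h3 := (abs_sub_abs_le_abs_sub _ _).trans h2
      linarith
  have hWν : ∀ n, ν (⋃ i, W n i)ᶜ = 0 := by
    intro n
    rw [hν, Measure.restrict_apply (MeasurableSet.iUnion (hWm n)).compl]
    convert measure_empty (μ := μ)
    exact (Set.disjoint_compl_left_iff_subset.2 (hWZ n)).inter_eq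
  obtain ⟨β, hβ0, hβ⟩ := ENNReal.exists_pos_sum_of_countable'
    (ENNReal.div_pos hνu (by finiteness : (2 : ℝ≥0∞) ≠ ⊤)).ne' ℕ
  choose C hCc hCν i σ hσ hCW hCσ using fun n =>
    exists_isCompact_locally_constant_selection ν (hWm n) (hWν n) (hβ0 n).ne'
  choose T hT B hBm hBν hB using fun (n : ℕ) (s : ℝ) =>
    exists_direction_window ν hξ s (hpow n) (hβ0 n).ne'
  set K := ⋂ n, C n with hK
  have hKc : IsCompact K := (hCc 0).of_isClosed_subset
    (isClosed_iInter fun n => (hCc n).isClosed) (Set.iInter_subset _ _)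
  have hKC : ∀ n, ∀ x ∈ K, x ∈ C n := fun n x hx => Set.mem_iInter.1 hx n
  -- Prescribed gradients: alternately a selected flat vector and `0`.
  set U : ℕ → X → EuclideanSpace ℝ (Fin N) := fun n x => if Odd n then V (i n x) else 0 with hU
  have hU1 : ∀ n x, ‖U n x‖ ≤ 1 := by
    intro n x
    simp only [hU]
    split_ifs
    · exact hV1 _
    · simp
  have hUloc : ∀ n, ∀ x ∈ K, ∀ x' ∈ K, dist x x' < σ n → U n x = U n x' := by
    intro n x hx x' hx' h
    simp only [hU]
    rw [hCσ n x (hKC n x hx) x' (hKC n x' hx') h]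
  have hUscale : ∀ n, Odd n → ∀ δ > 0, ∃ s > 0, ∃ r : X → ℝ, ∀ x ∈ K, s ≤ r x ∧ r x ≤ δ ∧
      ∀ y, dist x y < 2 * r x →
        |inner ℝ (U n x) (ξ y) - inner ℝ (U n x) (ξ x)| ≤ l * (1 / 2) ^ n / 4 * r x := by
    intro n hn δ hδ
    obtain ⟨s, hs, r, hr⟩ := hKc.exists_uniform_flat_scale
      (g := fun x y => inner ℝ (U n x) (ξ y)) (hσ n) (he0 n)
      (fun x _ y z => hinner _ (hU1 n x) y z)
      (fun x hx x' hx' h => by simp only [hUloc n x hx x' hx' h])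
      (fun x hx => by
        have : FlatAt _ _ x := (hCW n x (hKC n x hx)).1
        simpa only [hU, if_pos hn] using this) hδ
    refine ⟨s, hs, r, fun x hx => ⟨(hr x hx).1, (hr x hx).2.1, fun y hy => ?_⟩⟩
    refine ((hr x hx).2.2 y hy).trans (le_of_eq ?_)
    simp only [he]
    ring
  obtain ⟨f, s, hs, hf, hfU⟩ := exists_lipschitz_prescribed (K := K)
    (φ := fun n x y => inner ℝ (U n x) (ξ y)) hl0 (by simp [hU])
    (fun n x _ y z => hinner _ (hU1 n x) y z)
    (fun n => ⟨σ n, hσ n, fun x hx x' hx' h => by simp only [hUloc n x hx x' hx' h]⟩)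
    (by
      intro n δ hδ
      rcases Nat.even_or_odd n with hn | hn
      · obtain ⟨s, hs, r, hr⟩ := hUscale (n + 1) hn.add_one δ hδ
        refine ⟨s, hs, r, fun x hx => ⟨(hr x hx).1, (hr x hx).2.1, fun y hy => ⟨?_, ?_⟩⟩⟩
        · have h1 : U n x = 0 := if_neg (Nat.not_odd_iff_even.2 hn)
          have h2 : 0 < r x := hs.trans_le (hr x hx).1
          have h3 := hpow n
          simp only [h1, inner_zero_left, sub_zero, abs_zero]
          positivity
        · have h2 : 0 < r x := hs.trans_le (hr x hx).1
          refine ((hr x hx).2.2 y hy).trans (mul_le_mul_of_nonneg_right ?_ h2.le)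
          have := mul_pos hl0 (hpow n)
          rw [pow_succ]
          linarith
      · obtain ⟨s, hs, r, hr⟩ := hUscale n hn δ hδ
        refine ⟨s, hs, r, fun x hx => ⟨(hr x hx).1, (hr x hx).2.1, fun y hy =>
          ⟨(hr x hx).2.2 y hy, ?_⟩⟩⟩
        have h1 : U (n + 1) x = 0 := if_neg (Nat.not_odd_iff_even.2 hn.add_one)
        have h2 : 0 < r x := hs.trans_le (hr x hx).1
        have h3 := hpow n
        simp only [h1, inner_zero_left, sub_zero, abs_zero]
        positivity)
    (T := T) (fun n s _ => hT n s)
  refine ⟨f, ⟨⟨1 + 2 * l, by positivity⟩, LipschitzWith.of_dist_le_mul fun x y => hf x y⟩, ?_⟩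
  -- At the points of `G` every stage is controlled and every window sees all directions.
  set G := K \ ⋃ n, B n (s n) with hG
  have hGm : MeasurableSet G :=
    hKc.isClosed.measurableSet.diff (MeasurableSet.iUnion fun n => hBm n _)
  have hGν : ν G ≠ 0 := by
    intro h0
    have hsub : Set.univ ⊆ G ∪ ((⋃ n, (C n)ᶜ) ∪ ⋃ n, B n (s n)) := by
      intro x _
      by_cases h1 : x ∈ ⋃ n, B n (s n)
      · exact Or.inr (Or.inr h1)
      · by_cases h2 : x ∈ K
        · exact Or.inl ⟨h2, h1⟩
        · exact Or.inr (Or.inl (by simpa [hK] using h2))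
    have h1 : ν Set.univ ≤ 0 + (∑' n, β n + ∑' n, β n) := by
      refine (measure_mono hsub).trans ((measure_union_le _ _).trans (add_le_add h0.le ?_))
      refine (measure_union_le _ _).trans (add_le_add ?_ ?_)
      · exact (measure_iUnion_le _).trans (ENNReal.tsum_le_tsum hCν)
      · exact (measure_iUnion_le _).trans (ENNReal.tsum_le_tsum fun n => hBν n _)
    have h2 : 0 + (∑' n, β n + ∑' n, β n) < ν Set.univ := by
      rw [zero_add, ← ENNReal.add_halves (ν Set.univ)]
      exact ENNReal.add_lt_add hβ hβ
    exact absurd h1 (not_le.2 h2)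
  rw [hν, Measure.restrict_apply hGm] at hGν
  refine fun h0 => hGν (measure_mono_null ?_ h0)
  rintro x ⟨⟨hxK, hxB⟩, hxZ⟩
  refine ⟨hxZ, fun w hw => ?_⟩
  have hxB' : ∀ n, x ∉ B n (s n) := fun n h => hxB (Set.mem_iUnion.2 ⟨n, h⟩)
  obtain ⟨ρ, hρ, hw'⟩ := hw.eventually_abs_sub_le hl0
  -- A steep stage `n` and the flat stage `n + 1`, at scales where `f` is nearly its differential.
  obtain ⟨n, hn, hnρ, hnw⟩ : ∃ n, Odd n ∧ (1 / 2 : ℝ) ^ n < ρ ∧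
      (4 * ‖w‖ + 2) * (1 / 2 : ℝ) ^ n < l := by
    have h1 : Tendsto (fun n : ℕ => (1 / 2 : ℝ) ^ n) atTop (𝓝 0) :=
      tendsto_pow_atTop_nhds_zero_of_lt_one (by norm_num) (by norm_num)
    have h2 := (h1.const_mul (4 * ‖w‖ + 2)).eventually_lt_const (by simpa using hl0)
    obtain ⟨m, hm⟩ := eventually_atTop.1 ((h1.eventually_lt_const hρ).and h2)
    exact ⟨2 * m + 1, odd_two_mul_add_one m, hm _ (by omega)⟩
  have hpn : (1 / 2 : ℝ) ^ (n + 1) ≤ (1 / 2) ^ n :=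
    pow_le_pow_of_le_one (by norm_num) (by norm_num) (Nat.le_succ n)
  set v := V (i n x) with hv
  obtain ⟨y, hy0, hy, hsteep⟩ := (hCW n x (hKC n x hxK)).2 (min (s n) (s (n + 1)))
    (lt_min (hs n).1 (hs (n + 1)).1)
  rw [lt_min_iff] at hy
  rw [← inner_sub_right] at hsteep
  have window : ∀ k, dist x y < s k → (1 / 2 : ℝ) ^ k ≤ (1 / 2) ^ n →
      |inner ℝ (w - U k x) (ξ y - ξ x)| ≤
        (5 * l + 2 * (1 / 2) ^ n * ‖w - U k x‖) * dist x y := by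
    intro k hyk hkn
    obtain ⟨q, hqy, y', hy'T, hy's, hqy'⟩ := hB k (s k) x (hxB' k) y hy0 hyk
    have hy'0 : 0 < dist x y' := (hT k (s k)).trans_le hy'T
    refine abs_inner_sub_le_of_common_direction hy'0
      (hqy.le.trans (mul_le_mul_of_nonneg_right hkn dist_nonneg))
      (hqy'.le.trans (mul_le_mul_of_nonneg_right hkn dist_nonneg)) ?_
    have h1 := abs_le.1 (hw' y' (hy's.trans_le ((hs k).2.trans (hkn.trans hnρ.le))))
    have h2 := abs_le.1 (hfU k x hxK y' hy'T hy's)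
    rw [inner_sub_left]
    simp only [← inner_sub_right] at h2
    exact abs_le.2 ⟨by linarith, by linarith⟩
  -- Both stages see the direction of `y`, and force `w - v` and `w` to be small on it.
  have h1 := window n hy.1 le_rfl
  have h2 := window (n + 1) hy.2 hpn
  have hUn : U n x = v := if_pos hn
  have hUn1 : U (n + 1) x = 0 := if_neg (Nat.not_odd_iff_even.2 hn.add_one)
  rw [hUn, inner_sub_left] at h1
  rw [hUn1, sub_zero] at h2
  have h3 : ‖w - v‖ ≤ ‖w‖ + 1 := (norm_sub_le _ _).trans (by linarith [hV1 (i n x)])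
  have h4 : (1 / 2 : ℝ) ^ n * ‖w - v‖ ≤ (1 / 2) ^ n * (‖w‖ + 1) :=
    mul_le_mul_of_nonneg_left h3 (hpow n).le
  have h5 : |inner ℝ v (ξ y - ξ x)| ≤ (11 * l) * dist x y := by
    have h6 := abs_sub_abs_le_abs_sub (inner ℝ v (ξ y - ξ x)) (inner ℝ w (ξ y - ξ x))
    rw [abs_sub_comm] at h6
    have h7 : (5 * l + 2 * (1 / 2) ^ n * ‖w - v‖ + (5 * l + 2 * (1 / 2) ^ n * ‖w‖)) * dist x y ≤
        11 * l * dist x y := mul_le_mul_of_nonneg_right (by linarith) dist_nonneg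
    linarith
  have h6 : 11 * l * dist x y ≤ c / 2 * dist x y :=
    mul_le_mul_of_nonneg_right (by rw [hl]; linarith) dist_nonneg
  linarith

/-! ### Pointwise Lipschitz constants of linear functions -/

section PointwiseLipschitz

variable {X : Type*} [MetricSpace X]

theorem variation_le_add {f g h : X → ℝ} {x : X} {r a : ℝ} (hr : 0 < r)
    (H : ∀ y, dist y x ≤ r → |f y - f x| ≤ |g y - g x| + |h y - h x| + a * r) :
    variation f x r ≤ variation g x r + variation h x r + ENNReal.ofReal a := by
  refine iSup₂_le fun y hy => ?_
  have h1 : |f y - f x| / r ≤ |g y - g x| / r + |h y - h x| / r + a := by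
    rw [← add_div, ← sub_le_iff_le_add, ← sub_nonneg]
    have : (|g y - g x| + |h y - h x|) / r - (|f y - f x| / r - a) =
        (|g y - g x| + |h y - h x| + a * r - |f y - f x|) / r := by
      field_simp
      ring
    rw [this]
    exact div_nonneg (by linarith [H y (Metric.mem_closedBall.1 hy)]) hr.le
  refine (ENNReal.ofReal_le_ofReal h1).trans ?_
  refine ENNReal.ofReal_add_le.trans (add_le_add (ENNReal.ofReal_add_le.trans ?_) le_rfl)
  exact add_le_add (le_iSup₂ (f := fun y (_ : y ∈ Metric.closedBall x r) =>
    ENNReal.ofReal (|g y - g x| / r)) y hy) (le_iSup₂ (f := fun y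
      (_ : y ∈ Metric.closedBall x r) => ENNReal.ofReal (|h y - h x| / r)) y hy)

theorem variation_le_add_const {f g : X → ℝ} {x : X} {r a : ℝ} (hr : 0 < r)
    (H : ∀ y, dist y x ≤ r → |f y - f x| ≤ |g y - g x| + a * r) :
    variation f x r ≤ variation g x r + ENNReal.ofReal a := by
  have h := variation_le_add (f := f) (g := g) (h := fun _ => 0) (x := x) (a := a) hr
    (fun y hy => by simpa using H y hy)
  simpa [variation] using h

theorem upperPtLip_le_add {f g : X → ℝ} {x : X} {a : ℝ≥0∞}
    (H : ∀ᶠ r in 𝓝[>] (0 : ℝ), variation f x r ≤ variation g x r + a) :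
    upperPtLip f x ≤ upperPtLip g x + a := by
  unfold upperPtLip
  rw [← limsup_add_const _ _ _ (by isBoundedDefault) (by isBoundedDefault)]
  exact limsup_le_limsup H

theorem lowerPtLip_le_add {f g : X → ℝ} {x : X} {a : ℝ≥0∞}
    (H : ∀ᶠ r in 𝓝[>] (0 : ℝ), variation f x r ≤ variation g x r + a) :
    lowerPtLip f x ≤ lowerPtLip g x + a := by
  unfold lowerPtLip
  rw [← liminf_add_const _ _ _ (by isBoundedDefault) (by isBoundedDefault)]
  exact liminf_le_liminf H

theorem upperPtLip_le_of_forall_pos {f g : X → ℝ} {x : X}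
    (H : ∀ a > 0, ∀ᶠ r in 𝓝[>] (0 : ℝ), variation f x r ≤ variation g x r + ENNReal.ofReal a) :
    upperPtLip f x ≤ upperPtLip g x :=
  ENNReal.le_of_forall_pos_le_add fun a ha _ => by
    simpa using upperPtLip_le_add (H a ha)

theorem lowerPtLip_le_of_forall_pos {f g : X → ℝ} {x : X}
    (H : ∀ a > 0, ∀ᶠ r in 𝓝[>] (0 : ℝ), variation f x r ≤ variation g x r + ENNReal.ofReal a) :
    lowerPtLip f x ≤ lowerPtLip g x :=
  ENNReal.le_of_forall_pos_le_add fun a ha _ => by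
    simpa using lowerPtLip_le_add (H a ha)

theorem flatAt_of_lowerPtLip_eq_zero {g : X → ℝ} {x : X} (h : lowerPtLip g x = 0) {ε : ℝ}
    (hε : 0 < ε) : FlatAt g ε x := by
  intro δ hδ
  have h1 : liminf (fun r : ℝ => variation g x r) (𝓝[>] 0) < ENNReal.ofReal (ε / 6) := by
    change lowerPtLip g x < _
    rw [h]
    exact ENNReal.ofReal_pos.2 (by linarith)
  have h2 := (frequently_lt_of_liminf_lt (by isBoundedDefault) h1).and_eventually
    (Ioo_mem_nhdsGT hδ)
  obtain ⟨r, hr, hr0, hrδ⟩ := h2.exists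
  refine ⟨r / 3, by linarith, by linarith, ε / 2, by linarith, fun y hy => ?_⟩
  have h3 : ENNReal.ofReal (|g y - g x| / r) < ENNReal.ofReal (ε / 6) :=
    lt_of_le_of_lt (le_iSup₂ (f := fun y (_ : y ∈ Metric.closedBall x r) =>
      ENNReal.ofReal (|g y - g x| / r)) y (by
        rw [Metric.mem_closedBall, dist_comm]; linarith)) hr
  rw [ENNReal.ofReal_lt_ofReal_iff (by linarith), div_lt_iff₀ hr0] at h3
  linarith

theorem exists_steepAt_of_upperPtLip_ne_zero {g : X → ℝ} {x : X} (h : upperPtLip g x ≠ 0) :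
    ∃ c > 0, SteepAt g c x := by
  obtain ⟨c, hc0, hc⟩ := ENNReal.lt_iff_exists_nnreal_btwn.1 (pos_iff_ne_zero.2 h)
  have hc0' : 0 < (c : ℝ) := by simpa using hc0
  refine ⟨c, hc0', fun δ hδ => ?_⟩
  have h2 := (frequently_lt_of_lt_limsup (by isBoundedDefault) hc).and_eventually
    (Ioo_mem_nhdsGT hδ)
  obtain ⟨r, hr, hr0, hrδ⟩ := h2.exists
  obtain ⟨y, hr⟩ := lt_iSup_iff.1 hr
  obtain ⟨hy, hr⟩ := lt_iSup_iff.1 hr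
  rw [← ENNReal.ofReal_coe_nnreal, ENNReal.ofReal_lt_ofReal_iff_of_nonneg hc0'.le,
    lt_div_iff₀ hr0] at hr
  rw [Metric.mem_closedBall, dist_comm] at hy
  have hne : 0 < dist x y := by
    refine dist_pos.2 ?_
    rintro rfl
    simp only [sub_self, abs_zero] at hr
    have := mul_pos hc0' hr0
    linarith
  exact ⟨y, hne, hy.trans_lt hrδ, (mul_le_mul_of_nonneg_left hy hc0'.le).trans_lt hr⟩

variable {E : Type*} [NormedAddCommGroup E] [InnerProductSpace ℝ E] {ξ : X → E}

theorem variation_inner_le_add (hξ : ∀ x y, ‖ξ y - ξ x‖ ≤ dist x y) (u v : E) (x : X) {r : ℝ}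
    (hr : 0 < r) :
    variation (fun y => inner ℝ u (ξ y)) x r ≤
      variation (fun y => inner ℝ v (ξ y)) x r + ENNReal.ofReal ‖u - v‖ := by
  refine variation_le_add_const hr fun y hy => ?_
  rw [← inner_sub_right, ← inner_sub_right]
  have h1 : inner ℝ u (ξ y - ξ x) = inner ℝ v (ξ y - ξ x) + inner ℝ (u - v) (ξ y - ξ x) := by
    rw [inner_sub_left]; ring
  rw [h1]
  refine (abs_add_le _ _).trans (add_le_add le_rfl ((abs_real_inner_le_norm _ _).trans ?_))
  rw [dist_comm] at hy
  exact mul_le_mul_of_nonneg_left ((hξ x y).trans hy) (norm_nonneg _)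

/-- Adding a vector on which the upper constant vanishes changes the pointwise constants of a
linear function of `ξ` only by a term that tends to `0` with the radius. -/
theorem variation_inner_le_of_upperPtLip_sub_eq_zero {u v : E} {x : X}
    (h : upperPtLip (fun y => inner ℝ (u - v) (ξ y)) x = 0) :
    ∀ a > 0, ∀ᶠ r in 𝓝[>] (0 : ℝ), variation (fun y => inner ℝ u (ξ y)) x r ≤
      variation (fun y => inner ℝ v (ξ y)) x r + ENNReal.ofReal a := by
  intro a ha
  have h1 : limsup (fun r : ℝ => variation (fun y => inner ℝ (u - v) (ξ y)) x r) (𝓝[>] 0) <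
      ENNReal.ofReal a := by
    change upperPtLip _ x < _
    rw [h]
    exact ENNReal.ofReal_pos.2 ha
  filter_upwards [eventually_lt_of_limsup_lt h1 (by isBoundedDefault), self_mem_nhdsWithin]
    with r hr hr0
  have h2 := variation_le_add (f := fun y => inner ℝ u (ξ y)) (g := fun y => inner ℝ v (ξ y))
    (h := fun y => inner ℝ (u - v) (ξ y)) (x := x) (a := 0) hr0 (fun y _ => by
      simp only [← inner_sub_right]
      rw [zero_mul, add_zero]
      refine le_trans (le_of_eq ?_) (abs_add_le _ _)
      rw [inner_sub_left]
      congr 1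
      ring)
  rw [ENNReal.ofReal_zero, add_zero] at h2
  exact h2.trans (add_le_add le_rfl hr.le)

theorem variation_inner_smul (a : ℝ) (v : E) (x : X) (r : ℝ) :
    variation (fun y => inner ℝ (a • v) (ξ y)) x r =
      ENNReal.ofReal |a| * variation (fun y => inner ℝ v (ξ y)) x r := by
  simp only [variation, ENNReal.mul_iSup, ← ENNReal.ofReal_mul (abs_nonneg a), inner_smul_left,
    RCLike.conj_to_real, ← mul_sub, abs_mul, mul_div_assoc]

theorem upperPtLip_inner_smul (a : ℝ) (v : E) (x : X) :
    upperPtLip (fun y => inner ℝ (a • v) (ξ y)) x =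
      ENNReal.ofReal |a| * upperPtLip (fun y => inner ℝ v (ξ y)) x := by
  simp only [upperPtLip, variation_inner_smul]
  exact ENNReal.limsup_const_mul_of_ne_top ENNReal.ofReal_ne_top

theorem lowerPtLip_inner_smul (a : ℝ) (v : E) (x : X) :
    lowerPtLip (fun y => inner ℝ (a • v) (ξ y)) x =
      ENNReal.ofReal |a| * lowerPtLip (fun y => inner ℝ v (ξ y)) x := by
  simp only [lowerPtLip, variation_inner_smul]
  exact (Monotone.map_liminf_of_continuousAt (f := fun t => ENNReal.ofReal |a| * t)
    (fun _ _ h => mul_le_mul_right h _) _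
    (ENNReal.continuous_const_mul ENNReal.ofReal_ne_top).continuousAt
    (by isBoundedDefault) (by isBoundedDefault)).symm

theorem upperPtLip_inner_zero (x : X) :
    upperPtLip (fun y => inner ℝ (0 : E) (ξ y)) x = 0 := by
  have := upperPtLip_inner_smul (ξ := ξ) 0 (0 : E) x
  simpa using this

theorem upperPtLip_inner_le (hξ : ∀ x y, ‖ξ y - ξ x‖ ≤ dist x y) (v : E) (x : X) :
    upperPtLip (fun y => inner ℝ v (ξ y)) x ≤ ENNReal.ofReal ‖v‖ := by
  have h := upperPtLip_le_add (f := fun y => inner ℝ v (ξ y))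
    (g := fun y => inner ℝ (0 : E) (ξ y)) (x := x) (a := ENNReal.ofReal ‖v‖) (by
      filter_upwards [self_mem_nhdsWithin] with r hr
      simpa using variation_inner_le_add hξ v 0 x hr)
  rwa [upperPtLip_inner_zero, zero_add] at h

/-- The linear functions of `ξ` with vanishing upper constant at `x`. -/
def upperPtLipKer (ξ : X → E) (x : X) : Submodule ℝ E where
  carrier := {v | upperPtLip (fun y => inner ℝ v (ξ y)) x = 0}
  zero_mem' := upperPtLip_inner_zero x
  add_mem' := by
    intro u v hu hv
    refine nonpos_iff_eq_zero.1 ((upperPtLip_le_of_forall_pos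
      (variation_inner_le_of_upperPtLip_sub_eq_zero (u := u + v) (v := v) ?_)).trans (le_of_eq hv))
    rwa [add_sub_cancel_right]
  smul_mem' := by
    intro a v hv
    change upperPtLip _ x = 0 at hv
    change upperPtLip _ x = 0
    rw [upperPtLip_inner_smul, hv, mul_zero]

/-- If the lower constant of a linear function of `ξ` at `x` vanishes only together with the upper one,
then the two are comparable. This is compactness of the unit sphere in the orthogonal complement of
the kernel of the upper constant, to which every vector can be projected. -/
theorem exists_forall_upperPtLip_le_mul_lowerPtLip [FiniteDimensional ℝ E]
    (hξ : ∀ x y, ‖ξ y - ξ x‖ ≤ dist x y) {x : X}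
    (H : ∀ v : E, lowerPtLip (fun y => inner ℝ v (ξ y)) x = 0 →
      upperPtLip (fun y => inner ℝ v (ξ y)) x = 0) :
    ∃ n : ℕ+, ∀ v : E, upperPtLip (fun y => inner ℝ v (ξ y)) x ≤
      ((n : ℕ) : ℝ≥0∞) * lowerPtLip (fun y => inner ℝ v (ξ y)) x := by
  set M := upperPtLipKer ξ x with hM
  have hsphere : ∃ m > 0, ∀ v ∈ Metric.sphere (0 : E) 1, v ∈ Mᗮ →
      ENNReal.ofReal m ≤ lowerPtLip (fun y => inner ℝ v (ξ y)) x := by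
    refine (isCompact_sphere (0 : E) 1 |>.inter_right M.isClosed_orthogonal).induction_on
      (p := fun S => ∃ m > 0, ∀ v ∈ S, ENNReal.ofReal m ≤
        lowerPtLip (fun y => inner ℝ v (ξ y)) x) ⟨1, one_pos, by simp⟩ ?_ ?_ ?_ |>.imp
      fun m hm => ⟨hm.1, fun v hv hv' => hm.2 v ⟨hv, hv'⟩⟩
    · rintro S S' hS ⟨m, hm, h⟩
      exact ⟨m, hm, fun v hv => h v (hS hv)⟩
    · rintro S S' ⟨m, hm, h⟩ ⟨m', hm', h'⟩
      refine ⟨min m m', lt_min hm hm', ?_⟩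
      rintro v (hv | hv)
      · exact (ENNReal.ofReal_le_ofReal (min_le_left _ _)).trans (h v hv)
      · exact (ENNReal.ofReal_le_ofReal (min_le_right _ _)).trans (h' v hv)
    · rintro v ⟨hv1, hvM⟩
      have hv0 : lowerPtLip (fun y => inner ℝ v (ξ y)) x ≠ 0 := by
        intro h0
        have hvM' : v ∈ M := H v h0
        have h1 : v = 0 := by
          have := Submodule.inner_right_of_mem_orthogonal hvM' hvM
          exact inner_self_eq_zero.1 this
        rw [h1] at hv1
        simp at hv1
      obtain ⟨c, hc0, hc⟩ := ENNReal.lt_iff_exists_nnreal_btwn.1 (pos_iff_ne_zero.2 hv0)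
      have hc0' : 0 < (c : ℝ) := by simpa using hc0
      refine ⟨Metric.ball v (c / 2), mem_nhdsWithin_of_mem_nhds
        (Metric.ball_mem_nhds _ (by linarith)), c / 2, by linarith, fun u hu => ?_⟩
      have h1 := lowerPtLip_le_add (f := fun y => inner ℝ v (ξ y))
        (g := fun y => inner ℝ u (ξ y)) (x := x) (by
          filter_upwards [self_mem_nhdsWithin] with r hr
          exact variation_inner_le_add hξ v u x hr)
      rw [Metric.mem_ball, dist_comm, dist_eq_norm] at hu
      have h2 : ENNReal.ofReal (c / 2) + ENNReal.ofReal (c / 2) ≤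
          lowerPtLip (fun y => inner ℝ u (ξ y)) x + ENNReal.ofReal (c / 2) := by
        rw [← ENNReal.ofReal_add (by linarith) (by linarith), add_halves,
          ENNReal.ofReal_coe_nnreal]
        exact hc.le.trans (h1.trans (add_le_add le_rfl (ENNReal.ofReal_le_ofReal hu.le)))
      exact (ENNReal.add_le_add_iff_right ENNReal.ofReal_ne_top).1 h2
  obtain ⟨m, hm, hsphere⟩ := hsphere
  obtain ⟨k, hk⟩ := exists_nat_gt (1 / m)
  have hk0 : 0 < k := by
    have : (0 : ℝ) < k := lt_trans (by positivity) hk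
    exact_mod_cast this
  refine ⟨⟨k, hk0⟩, fun v => ?_⟩
  set u := v - M.starProjection v with hu
  have huM : u ∈ Mᗮ := M.sub_starProjection_mem_orthogonal v
  have hvu : v - u ∈ M := by
    rw [hu, sub_sub_cancel]
    exact M.starProjection_apply_mem v
  have huv : u - v ∈ M := by
    rw [← neg_sub]
    exact M.neg_mem hvu
  refine (upperPtLip_le_of_forall_pos
    (variation_inner_le_of_upperPtLip_sub_eq_zero hvu)).trans (le_trans ?_ (mul_le_mul_right
      (lowerPtLip_le_of_forall_pos (variation_inner_le_of_upperPtLip_sub_eq_zero huv)) _))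
  by_cases hu0 : u = 0
  · rw [hu0, upperPtLip_inner_zero]
    exact zero_le
  have hun : 0 < ‖u‖ := norm_pos_iff.2 hu0
  have h1 := hsphere (‖u‖⁻¹ • u) (by simp [norm_smul, hun.ne']) (Mᗮ.smul_mem _ huM)
  have h2 : u = ‖u‖ • (‖u‖⁻¹ • u) := (smul_inv_smul₀ hun.ne' u).symm
  have h3 : lowerPtLip (fun y => inner ℝ u (ξ y)) x =
      ENNReal.ofReal ‖u‖ * lowerPtLip (fun y => inner ℝ (‖u‖⁻¹ • u) (ξ y)) x := by
    conv_lhs => rw [h2]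
    rw [lowerPtLip_inner_smul, abs_of_pos hun]
  rw [h3]
  calc upperPtLip (fun y => inner ℝ u (ξ y)) x ≤ ENNReal.ofReal ‖u‖ := upperPtLip_inner_le hξ u x
    _ = 1 * ENNReal.ofReal ‖u‖ := (one_mul _).symm
    _ ≤ ((k : ℝ≥0∞) * ENNReal.ofReal m) * ENNReal.ofReal ‖u‖ := by
        gcongr
        rw [← ENNReal.ofReal_natCast, ← ENNReal.ofReal_mul (by positivity), ENNReal.one_le_ofReal]
        exact ((div_lt_iff₀ hm).1 hk).le
    _ = (k : ℝ≥0∞) * (ENNReal.ofReal ‖u‖ * ENNReal.ofReal m) := by ring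
    _ ≤ _ := by
        rw [PNat.mk_coe]
        gcongr

end PointwiseLipschitz

/-- At a point of differentiability, `f` has the same pointwise constants as its differential; only
the two inequalities that are needed are stated. -/
theorem HasDifferentialAt.upperPtLip_le_and_le_lowerPtLip {X : Type*} [MetricSpace X] {N : ℕ}
    {ξ : X → EuclideanSpace ℝ (Fin N)} {f : X → ℝ} {w : EuclideanSpace ℝ (Fin N)} {x : X}
    (h : HasDifferentialAt ξ f w x) :
    upperPtLip f x ≤ upperPtLip (fun y => inner ℝ w (ξ y)) x ∧
      lowerPtLip (fun y => inner ℝ w (ξ y)) x ≤ lowerPtLip f x := by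
  have key : ∀ a > 0, ∀ᶠ r in 𝓝[>] (0 : ℝ), 0 < r ∧ ∀ y, dist y x ≤ r →
      |(f y - f x) - (inner ℝ w (ξ y) - inner ℝ w (ξ x))| ≤ a * r := by
    intro a ha
    obtain ⟨ρ, hρ, hev⟩ := h.eventually_abs_sub_le ha
    filter_upwards [Ioo_mem_nhdsGT hρ] with r hr
    refine ⟨hr.1, fun y hy => ?_⟩
    rw [dist_comm] at hy
    rw [← inner_sub_right]
    exact (hev y (hy.trans_lt hr.2)).trans (mul_le_mul_of_nonneg_left hy ha.le)
  refine ⟨upperPtLip_le_of_forall_pos fun a ha => ?_, lowerPtLip_le_of_forall_pos fun a ha => ?_⟩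
  · filter_upwards [key a ha] with r hr
    refine variation_le_add_const hr.1 fun y hy => ?_
    linarith [hr.2 y hy, abs_sub_abs_le_abs_sub (f y - f x) (inner ℝ w (ξ y) - inner ℝ w (ξ x))]
  · filter_upwards [key a ha] with r hr
    refine variation_le_add_const hr.1 fun y hy => ?_
    have h1 := hr.2 y hy
    rw [abs_sub_comm] at h1
    linarith [abs_sub_abs_le_abs_sub (inner ℝ w (ξ y) - inner ℝ w (ξ x)) (f y - f x)]

/-! ### Charts of differentiability -/

/-- In a chart of differentiability, at almost every point, every linear function of the coordinates
with vanishing lower constant has vanishing upper constant. -/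
theorem IsDiffChart.measure_setOf_lowerPtLip_eq_zero {X : Type*} [MetricSpace X]
    [MeasurableSpace X] [BorelSpace X] [ProperSpace X] {N : ℕ} {μ : Measure X}
    [IsLocallyFiniteMeasure μ] {Y : Set X}
    {ξ : X → EuclideanSpace ℝ (Fin N)} (hξ : ∀ x y, ‖ξ y - ξ x‖ ≤ dist x y)
    (hY : IsDiffChart μ Y ξ) :
    μ {x | x ∈ Y ∧ ∃ v, lowerPtLip (fun y => inner ℝ v (ξ y)) x = 0 ∧
      upperPtLip (fun y => inner ℝ v (ξ y)) x ≠ 0} = 0 := by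
  obtain hX | ⟨⟨o⟩⟩ := isEmpty_or_nonempty X
  · rw [Set.eq_empty_of_isEmpty {x | _}, measure_empty]
  -- A countable exhaustion by bounded sets with normalized vectors and uniform steepness.
  set Z : ℕ → Set X := fun k => {x | (x ∈ Y ∧ dist x o ≤ k) ∧
    ∃ v : EuclideanSpace ℝ (Fin N), ‖v‖ ≤ 1 ∧
      (∀ ε > 0, FlatAt (fun y => inner ℝ v (ξ y)) ε x) ∧
      SteepAt (fun y => inner ℝ v (ξ y)) (1 / (k + 1 : ℝ)) x} with hZ
  have hZ0 : ∀ k, μ (Z k) = 0 := by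
    intro k
    by_contra hne
    have htop : μ (Z k) ≠ ⊤ := by
      refine ne_top_of_le_ne_top (isCompact_closedBall o (k : ℝ)).measure_lt_top.ne
        (measure_mono fun x hx => ?_)
      exact Metric.mem_closedBall.2 hx.1.2
    obtain ⟨f, hf, hfZ⟩ := exists_lipschitz_not_differentiable μ hξ hne htop
      (c := 1 / (k + 1 : ℝ)) (by positivity) fun x hx => hx.2
    obtain ⟨D, ⟨-, hD⟩, -⟩ := hY.existsUnique_differential f hf
    rw [ae_restrict_iff'₀ hY.nullMeasurableSet, ae_iff] at hD
    exact hfZ (measure_mono_null (fun x hx => fun hx' : x ∈ Y → _ => hx.2 _ (hx' hx.1.1.1)) hD)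
  refine measure_mono_null (fun x hx => ?_) (measure_iUnion_null hZ0)
  obtain ⟨hxY, v, hv0, hv⟩ := hx
  have hvne : v ≠ 0 := by
    rintro rfl
    exact hv (upperPtLip_inner_zero x)
  have hvn : 0 < ‖v‖ := norm_pos_iff.2 hvne
  have hlow : lowerPtLip (fun y => inner ℝ (‖v‖⁻¹ • v) (ξ y)) x = 0 := by
    rw [lowerPtLip_inner_smul, hv0, mul_zero]
  have hupp : upperPtLip (fun y => inner ℝ (‖v‖⁻¹ • v) (ξ y)) x ≠ 0 := by
    rw [upperPtLip_inner_smul]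
    refine mul_ne_zero (ENNReal.ofReal_pos.2 ?_).ne' hv
    positivity
  obtain ⟨c, hc, hsteep⟩ := exists_steepAt_of_upperPtLip_ne_zero hupp
  obtain ⟨k₁, hk₁⟩ := exists_nat_one_div_lt hc
  obtain ⟨k₂, hk₂⟩ := exists_nat_ge (dist x o)
  refine Set.mem_iUnion.2 ⟨max k₁ k₂, ⟨hxY, hk₂.trans (by exact_mod_cast le_max_right _ _)⟩,
    ‖v‖⁻¹ • v, by simp [norm_smul, hvn.ne'], fun ε hε => flatAt_of_lowerPtLip_eq_zero hlow hε,
    fun δ hδ => ?_⟩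
  obtain ⟨y, hy0, hy, h⟩ := hsteep δ hδ
  refine ⟨y, hy0, hy, lt_of_le_of_lt (mul_le_mul_of_nonneg_right ?_ hy0.le) h⟩
  exact (Nat.one_div_le_one_div (le_max_left k₁ k₂)).trans hk₁.le

/-- Here `μ.support`, with the Euclidean metric and the restriction of `μ` to it, is the metric
measure space in which both the chart and the pointwise Lipschitz constants are taken. -/
theorem proposition4p2 (N : ℕ) (μ : Measure (EuclideanSpace ℝ (Fin N)))
    [IsLocallyFiniteMeasure μ] (A : Set (EuclideanSpace ℝ (Fin N))) (hAS : A ⊆ μ.support)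
    (hA : IsDiffChart (X := μ.support)
      (μ.comap (Subtype.val : μ.support → EuclideanSpace ℝ (Fin N)))
      (Subtype.val ⁻¹' A)
      (Subtype.val : μ.support → EuclideanSpace ℝ (Fin N))) :
    ∃ 𝒜 : ℕ+ → Set (EuclideanSpace ℝ (Fin N)),
      (∀ n, 𝒜 n ⊆ A) ∧ μ (A \ ⋃ n, 𝒜 n) = 0 ∧
      ∀ n : ℕ+, ∀ f : EuclideanSpace ℝ (Fin N) → ℝ, (∃ K : ℝ≥0, LipschitzWith K f) →
        ∀ᵐ a ∂μ, ∀ ha : a ∈ μ.support, a ∈ 𝒜 n →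
          upperPtLip (fun x : μ.support => f x) ⟨a, ha⟩ ≤
            ((n : ℕ) : ℝ≥0∞) * lowerPtLip (fun x : μ.support => f x) ⟨a, ha⟩ := by
  have hS : IsClosed μ.support := Measure.isClosed_support
  have : ProperSpace μ.support := .of_isClosed hS
  have hemb : MeasurableEmbedding (Subtype.val : μ.support → EuclideanSpace ℝ (Fin N)) :=
    MeasurableEmbedding.subtype_coe hS.measurableSet
  set μS := μ.comap (Subtype.val : μ.support → EuclideanSpace ℝ (Fin N)) with hμS
  have : IsLocallyFiniteMeasure μS := ⟨fun x => by
    obtain ⟨U, hU, hμU⟩ := μ.finiteAt_nhds (x : EuclideanSpace ℝ (Fin N))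
    refine ⟨Subtype.val ⁻¹' U, continuous_subtype_val.continuousAt hU, ?_⟩
    rw [hμS, hemb.comap_apply]
    exact (measure_mono (Set.image_preimage_subset _ _)).trans_lt hμU⟩
  set ξ : μ.support → EuclideanSpace ℝ (Fin N) := Subtype.val with hξdef
  have hξ : ∀ x y : μ.support, ‖ξ y - ξ x‖ ≤ dist x y := fun x y => by
    rw [dist_comm, Subtype.dist_eq, dist_eq_norm]
  have hnull := hA.measure_setOf_lowerPtLip_eq_zero hξ
  rw [hμS, hemb.comap_apply] at hnull
  refine ⟨fun n => {a | a ∈ A ∧ ∃ ha : a ∈ μ.support, ∀ v : EuclideanSpace ℝ (Fin N),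
    upperPtLip (fun y => inner ℝ v (ξ y)) ⟨a, ha⟩ ≤
      ((n : ℕ) : ℝ≥0∞) * lowerPtLip (fun y => inner ℝ v (ξ y)) ⟨a, ha⟩},
    fun n a ha => ha.1, measure_mono_null ?_ hnull, fun n f ⟨L, hf⟩ => ?_⟩
  · rintro a ⟨haA, ha⟩
    refine ⟨⟨a, hAS haA⟩, ⟨haA, ?_⟩, rfl⟩
    by_contra! H
    obtain ⟨n, hn⟩ := exists_forall_upperPtLip_le_mul_lowerPtLip hξ H
    exact ha (Set.mem_iUnion.2 ⟨n, haA, hAS haA, hn⟩)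
  · obtain ⟨D, ⟨-, hD⟩, -⟩ := hA.existsUnique_differential (fun x => f x)
      ⟨L, fun x y => hf x y⟩
    rw [ae_restrict_iff'₀ hA.nullMeasurableSet, ae_iff, hμS, hemb.comap_apply] at hD
    refine measure_mono_null (fun a ha => ?_) hD
    simp only [Set.mem_compl_iff, Set.mem_ofPred_eq, not_forall] at ha
    obtain ⟨haS, ⟨haA, _, hn⟩, hlt⟩ := ha
    refine ⟨⟨a, haS⟩, fun hdiff => hlt ?_, rfl⟩
    have h := (hdiff haA).upperPtLip_le_and_le_lowerPtLip
    exact h.1.trans ((hn _).trans (mul_le_mul_right h.2 _))
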